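/- Let $n\in\mathbb N$, $h>0$, $a\in\mathbb R$, $\nu\in(0,1]$, and $(h\mathbb N)_b=\{b,b+h,b+2h,\dots\}$. For $y$ defined on $(h\mathbb N)_a$ put $(\Delta_h y)(t)=\frac{y(t+h)-y(t)}{h}$, $t_h^{(\mu)}=h^{\mu}\,\Gamma(\tfrac th+1)/\Gamma(\tfrac th+1-\mu)$, ${}_a\Delta_h^{0}y=y$ and, for $\mu>0$, $$({}_a\Delta_h^{-\mu}y)(t)=\frac{h}{\Gamma(\mu)}\sum_{s=a/h}^{t/h-\mu}(t-(s+1)h)_h^{(\mu-1)}\,y(sh),\qquad t\in(h\mathbb N)_{a+\mu h},$$ the sum running over $s=\frac ah,\frac ah+1,\dots,\frac th-\mu$. The Riemann–Liouville-like fractional $h$-difference of order $\nu$ is ${}_a\Delta_h^{\nu}y=\Delta_h({}_a\Delta_h^{-(1-\nu)}y)$ on $(h\mathbb N)_{a+(1-\nu)h}$; these operators act componentwise on $\mathbb R^n$-valued functions. Let $f:(h\mathbb N)_{a+(1-\nu)h}\times\mathbb R^n\to\mathbb R^n$ be continuous in its second variable and consider $$({}_a\Delta_h^{\nu}x)(t)=f(t,x(t+\nu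 h)),\quad t\in(h\mathbb N)_{a+(1-\nu)h},\qquad ({}_a\Delta_h^{\nu-1}x)(t)\big|_{t=a+(1-\nu)h}=h^{1-\nu}x_0\in\mathbb R^n.\tag{$*$}$$ Assume that $x=0$ is an equilibrium point of $(*)$, i.e. $f(t,0)=0$ for all $t\in(h\mathbb N)_{a+(1-\nu)h}$, and let $P\in\mathbb R^{n\times n}$ be symmetric positive definite. The system $(*)$ is called stable if for each $\varepsilon>0$ there is $\delta>0$ such that every solution $x:(h\mathbb N)_a\to\mathbb R^n$ of $(*)$ (for any $x_0$) with $\|x(a)\|<\delta$ satisfies $\|x(a+kh)\|<\varepsilon$ for all $k\in\mathbb N_0$; attractive if there is $\delta>0$ such that every solution with $\|x(a)\|<\delta$ satisfies $\lim_{k\to\infty}x(a+kh)=0$; and asymptotically stable if it is stable and attractive. 1. If every solution $x$ of $(*)$ satisfies $$x^T(t+\nu h)\,P f(t,x(t+\nu h))\le 0\qquad\text{for all }t\in(h\mathbb N)_{a+(1-\nu)h},$$ then $(*)$ is stable. 2. If every solution $x$ of $(*)$ satisfies $$x^T(t+\nu h)\,P f(t,x(t+\nu h))<0\qquad\text{for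 all }t\in(h\mathbb N)_{a+(1-\nu)h}\text{ with }x(t+\nu h)\neq0,$$ and if, in the non-fractional case $\nu=1$ only, this expression is moreover negative definite uniformly in $t$, i.e. there are $\rho>0$ and a continuous strictly increasing $\varphi:[0,\rho)\to[0,\infty)$ with $\varphi(0)=0$ such that $x^T(t+\nu h)Pf(t,x(t+\nu h))\le-\varphi(\|x(t+\nu h)\|)$ for all solutions $x$ and all $t\in(h\mathbb N)_{a+(1-\nu)h}$ with $\|x(t+\nu h)\|<\rho$, then $(*)$ is asymptotically stable. -/

import Mathlib

namespace HDiff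

/-- The grid `(hℕ)_a = {a, a + h, a + 2h, …}`. Functions on a grid are written below as functions
on `ℝ`; only their values at grid points are ever used. -/
def grid (h a : ℝ) : Set ℝ := {t | ∃ k : ℕ, t = a + k * h}

/-- The forward `h`-difference `(Δ_h y)(t) = (y(t+h) - y(t)) / h`. -/
noncomputable def forwardDiff {E : Type*} [AddCommGroup E] [Module ℝ E] (h : ℝ) (y : ℝ → E)
    (t : ℝ) : E :=
  h⁻¹ • (y (t + h) - y t)

/-- The `h`-factorial function `t_h^{(ν)} = h^ν Γ(t/h+1) / Γ(t/h+1-ν)`. It is `0` when `t/h+1-ν` is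
a nonpositive integer (`Real.Gamma` is `0` there, and division by `0` gives `0`). -/
noncomputable def factorial (h t ν : ℝ) : ℝ :=
  h ^ ν * Real.Gamma (t / h + 1) / Real.Gamma (t / h + 1 - ν)

open Classical in
/-- The fractional `h`-sum of order `ν ≥ 0`,
`(_aΔ_h^{-ν} y)(t) = (h/Γ(ν)) ∑_{s=a/h}^{t/h-ν} (t-σ(sh))_h^{(ν-1)} y(sh)` for `t ∈ (hℕ)_{a+νh}`,
and `_aΔ_h^{0} y = y`. The summation variable is `s = a/h + j`, so `sh = a + jh`,
`σ(sh) = a + (j+1)h`, where `j` runs over `0, …, (t-a)/h - ν`. -/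
noncomputable def fracSum {E : Type*} [AddCommGroup E] [Module ℝ E] (h a ν : ℝ) (y : ℝ → E)
    (t : ℝ) : E :=
  if ν = 0 then y t
  else (h / Real.Gamma ν) •
    ∑ j ∈ Finset.range (⌊(t - a) / h - ν⌋₊ + 1),
      factorial h (t - (a + ((j : ℝ) + 1) * h)) (ν - 1) • y (a + (j : ℝ) * h)

/-- The Riemann–Liouville-like fractional `h`-difference of order `ν > 0`:
`_aΔ_h^ν y = Δ_h^m (_aΔ_h^{-(m-ν)} y)`, where `m = ⌈ν⌉`, i.e. `ν ∈ (m-1, m]`. -/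
noncomputable def rlDiff {E : Type*} [AddCommGroup E] [Module ℝ E] (h a ν : ℝ) (y : ℝ → E) :
    ℝ → E :=
  (forwardDiff h)^[⌈ν⌉₊] (fracSum h a ((⌈ν⌉₊ : ℝ) - ν) y)

/-- `x` solves the initial value problem `(_aΔ_h^ν x)(t) = f(t, x(t+νh))`, `t ∈ (hℕ)_{a+(1-ν)h}`,
`(_aΔ_h^{ν-1} x)(a+(1-ν)h) = h^{1-ν} x₀` (here `_aΔ_h^{ν-1}` is the fractional sum of
order `1-ν`). -/
def IsSolution {n : ℕ} (h a ν : ℝ)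
    (f : ℝ → EuclideanSpace ℝ (Fin n) → EuclideanSpace ℝ (Fin n))
    (x₀ : EuclideanSpace ℝ (Fin n)) (x : ℝ → EuclideanSpace ℝ (Fin n)) : Prop :=
  (∀ t ∈ grid h (a + (1 - ν) * h), rlDiff h a ν x t = f t (x (t + ν * h))) ∧
    fracSum h a (1 - ν) x (a + (1 - ν) * h) = h ^ (1 - ν) • x₀

/-- The constant vector `c` is an equilibrium point of `(_aΔ_h^ν x)(t) = f(t, x(t+νh))`. -/
def IsEquilibrium {n : ℕ} (h a ν : ℝ)
    (f : ℝ → EuclideanSpace ℝ (Fin n) → EuclideanSpace ℝ (Fin n))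
    (c : EuclideanSpace ℝ (Fin n)) : Prop :=
  ∀ t ∈ grid h (a + (1 - ν) * h), rlDiff h a ν (fun _ => c) t = f t c

/-- The equilibrium `0` is stable. -/
def Stable {n : ℕ} (h a ν : ℝ)
    (f : ℝ → EuclideanSpace ℝ (Fin n) → EuclideanSpace ℝ (Fin n)) : Prop :=
  ∀ ε > 0, ∃ δ > 0, ∀ x₀ x, IsSolution h a ν f x₀ x → ‖x a‖ < δ →
    ∀ k : ℕ, ‖x (a + (k : ℝ) * h)‖ < ε

/-- The equilibrium `0` is attractive. -/
def Attractive {n : ℕ} (h a ν : ℝ)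
    (f : ℝ → EuclideanSpace ℝ (Fin n) → EuclideanSpace ℝ (Fin n)) : Prop :=
  ∃ δ > 0, ∀ x₀ x, IsSolution h a ν f x₀ x → ‖x a‖ < δ →
    Filter.Tendsto (fun k : ℕ => x (a + (k : ℝ) * h)) Filter.atTop (nhds 0)

/-- The equilibrium `0` is asymptotically stable. -/
def AsymptoticallyStable {n : ℕ} (h a ν : ℝ)
    (f : ℝ → EuclideanSpace ℝ (Fin n) → EuclideanSpace ℝ (Fin n)) : Prop :=
  Stable h a ν f ∧ Attractive h a ν f

/-- Class `𝒦` functions on `[0, ρ)`: continuous, zero at zero and strictly increasing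
(hence with values in `[0, ∞)`). -/
def ClassK (ρ : ℝ) (φ : ℝ → ℝ) : Prop :=
  ContinuousOn φ (Set.Ico 0 ρ) ∧ φ 0 = 0 ∧ StrictMonoOn φ (Set.Ico 0 ρ)

/-- The bilinear form `uᵀ P v`. -/
noncomputable def form {n : ℕ} (P : Matrix (Fin n) (Fin n) ℝ) (u v : EuclideanSpace ℝ (Fin n)) :
    ℝ :=
  u.ofLp ⬝ᵥ (P.mulVec v.ofLp)

end HDiff

/-! On the grid the fractional sum of order `μ` is `h ^ μ` times convolution with the Taylor
coefficients of `(1 - z) ^ (-μ)`. With `μ = 1 - ν` these decrease, so the equation says that `y (k +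
1)` minus a nonnegative combination of the past values equals `h ^ ν • f`. Pairing with `y (k + 1)`
in the inner product of `P` gives `‖y (k + 1)‖ ≤ ∑ d j * ‖y j‖`. The sequence `coef ν` satisfies
this recursion with equality, hence `‖y k‖ ≤ coef ν k * ‖y 0‖` (`norm_le_coef_mul`). Stability
follows from `coef ν ≤ 1`, attractivity for `ν < 1` from `coef ν k → 0`. For `ν = 1` all these
coefficients are `1`, and the uniform bound `φ` must exclude a positive limit of the norms
(`tendsto_norm_zero_of_inner_sub_le`). -/

namespace HDiff

/-! ### Binomial coefficients of `(1 - z) ^ (-μ)`. -/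

/-- The Taylor coefficients `μ (μ + 1) ⋯ (μ + m - 1) / m!` of `(1 - z) ^ (-μ)`. -/
noncomputable def coef (μ : ℝ) (m : ℕ) : ℝ := ∏ i ∈ Finset.range m, ((i : ℝ) + μ) / ((i : ℝ) + 1)

@[simp] theorem coef_zero (μ : ℝ) : coef μ 0 = 1 := by simp [coef]

theorem coef_succ (μ : ℝ) (m : ℕ) : coef μ (m + 1) = coef μ m * (((m : ℝ) + μ) / ((m : ℝ) + 1)) :=
  Finset.prod_range_succ _ _

theorem succ_mul_coef_succ (μ : ℝ) (m : ℕ) :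
    ((m : ℝ) + 1) * coef μ (m + 1) = ((m : ℝ) + μ) * coef μ m := by
  rw [coef_succ]
  have : (m : ℝ) + 1 ≠ 0 := by positivity
  field_simp

theorem coef_nonneg {μ : ℝ} (hμ : 0 ≤ μ) (m : ℕ) : 0 ≤ coef μ m :=
  Finset.prod_nonneg fun i _ => by positivity

theorem coef_succ_le {μ : ℝ} (hμ : 0 ≤ μ) (hμ₁ : μ ≤ 1) (m : ℕ) : coef μ (m + 1) ≤ coef μ m := by
  rw [coef_succ]
  refine mul_le_of_le_one_right (coef_nonneg hμ m) ?_
  rw [div_le_one (by positivity)]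
  linarith

theorem coef_le_one {μ : ℝ} (hμ : 0 ≤ μ) (hμ₁ : μ ≤ 1) (m : ℕ) : coef μ m ≤ 1 := by
  simpa using antitone_nat_of_succ_le (coef_succ_le hμ hμ₁) (Nat.zero_le m)

/-- Cauchy product for `(1 - z) ^ (-μ) * (1 - z) ^ (-μ') = (1 - z)⁻¹`. Weighting by `k + 1 = p.1 +
p.2` and shifting each index shows that the sum does not depend on `k`. -/
theorem sum_antidiagonal_coef_mul {μ μ' : ℝ} (h : μ + μ' = 1) (k : ℕ) :
    ∑ p ∈ Finset.HasAntidiagonal.antidiagonal k, coef μ p.1 * coef μ' p.2 = 1 := by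
  induction k with
  | zero => simp
  | succ k ih =>
    have hk : (k : ℝ) + 1 ≠ 0 := by positivity
    have h1 : ∑ p ∈ Finset.HasAntidiagonal.antidiagonal (k + 1), (p.1 : ℝ) * (coef μ p.1 * coef μ' p.2) =
        ∑ p ∈ Finset.HasAntidiagonal.antidiagonal k, ((p.1 : ℝ) + μ) * (coef μ p.1 * coef μ' p.2) := by
      rw [Finset.Nat.sum_antidiagonal_succ]
      simp only [Nat.cast_zero, zero_mul, zero_add, Nat.cast_add, Nat.cast_one]
      refine Finset.sum_congr rfl fun p _ => ?_
      rw [← mul_assoc, succ_mul_coef_succ, mul_assoc]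
    have h2 : ∑ p ∈ Finset.HasAntidiagonal.antidiagonal (k + 1), (p.2 : ℝ) * (coef μ p.1 * coef μ' p.2) =
        ∑ p ∈ Finset.HasAntidiagonal.antidiagonal k, ((p.2 : ℝ) + μ') * (coef μ p.1 * coef μ' p.2) := by
      rw [Finset.Nat.sum_antidiagonal_succ']
      simp only [Nat.cast_zero, zero_mul, zero_add, Nat.cast_add, Nat.cast_one]
      refine Finset.sum_congr rfl fun p _ => ?_
      rw [mul_left_comm, succ_mul_coef_succ, mul_left_comm]
    refine mul_left_cancel₀ hk ?_
    calc ((k : ℝ) + 1) * ∑ p ∈ Finset.HasAntidiagonal.antidiagonal (k + 1), coef μ p.1 * coef μ' p.2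
        = ∑ p ∈ Finset.HasAntidiagonal.antidiagonal (k + 1), (p.1 : ℝ) * (coef μ p.1 * coef μ' p.2) +
          ∑ p ∈ Finset.HasAntidiagonal.antidiagonal (k + 1), (p.2 : ℝ) * (coef μ p.1 * coef μ' p.2) := by
          rw [Finset.mul_sum, ← Finset.sum_add_distrib]
          refine Finset.sum_congr rfl fun p hp => ?_
          rw [← add_mul, ← Nat.cast_add, Finset.HasAntidiagonal.mem_antidiagonal.1 hp, Nat.cast_add, Nat.cast_one]
      _ = ((k : ℝ) + 1) * ∑ p ∈ Finset.HasAntidiagonal.antidiagonal k, coef μ p.1 * coef μ' p.2 := by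
          rw [h1, h2, Finset.mul_sum, ← Finset.sum_add_distrib]
          refine Finset.sum_congr rfl fun p hp => ?_
          rw [← add_mul, ← Finset.HasAntidiagonal.mem_antidiagonal.1 hp, Nat.cast_add, ← h]
          ring
      _ = ((k : ℝ) + 1) * 1 := by rw [ih]

theorem sum_range_coef_mul {μ μ' : ℝ} (h : μ + μ' = 1) (k : ℕ) :
    ∑ j ∈ Finset.range (k + 1), coef μ (k - j) * coef μ' j = 1 := by
  rw [← sum_antidiagonal_coef_mul ((add_comm μ' μ).trans h) k,
    Finset.Nat.sum_antidiagonal_eq_sum_range_succ_mk]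
  exact Finset.sum_congr rfl fun j _ => mul_comm _ _

theorem coef_le_rpow {μ : ℝ} (hμ : 0 ≤ μ) (hμ₁ : μ ≤ 1) (k : ℕ) :
    coef μ k ≤ ((k : ℝ) + 1) ^ (-(1 - μ)) := by
  induction k with
  | zero => simp
  | succ k ih =>
    have hk : (0 : ℝ) < (k : ℝ) + 1 := by positivity
    -- With `u = (1 - μ) / (k + 1)`, Bernoulli bounds this power by `1 + u`; the new factor of
    -- `coef` is `1 - u`, and `(1 - u) * (1 + u) ≤ 1`.
    have hb : (1 + 1 / ((k : ℝ) + 1)) ^ (1 - μ) ≤ 1 + (1 - μ) * (1 / ((k : ℝ) + 1)) :=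
      rpow_one_add_le_one_add_mul_self
        (le_trans (by norm_num) (by positivity : (0 : ℝ) ≤ 1 / ((k : ℝ) + 1)))
        (by linarith) (by linarith)
    have hq : (0 : ℝ) < (1 + 1 / ((k : ℝ) + 1)) ^ (1 - μ) := by positivity
    have hfac : ((k : ℝ) + μ) / ((k : ℝ) + 1) ≤ (1 + 1 / ((k : ℝ) + 1)) ^ (-(1 - μ)) := by
      rw [Real.rpow_neg (by positivity), ← one_div, le_div_iff₀ hq]
      have h0 : 0 ≤ ((k : ℝ) + μ) / ((k : ℝ) + 1) := by positivity
      refine (mul_le_mul_of_nonneg_left hb h0).trans ?_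
      have : ((k : ℝ) + μ) / ((k : ℝ) + 1) = 1 - (1 - μ) * (1 / ((k : ℝ) + 1)) := by
        field_simp
        ring
      rw [this]
      nlinarith [sq_nonneg ((1 - μ) * (1 / ((k : ℝ) + 1)))]
    have hsplit : ((k + 1 : ℕ) : ℝ) + 1 = ((k : ℝ) + 1) * (1 + 1 / ((k : ℝ) + 1)) := by
      push_cast
      field_simp
    rw [coef_succ, hsplit, Real.mul_rpow hk.le (by positivity)]
    exact mul_le_mul ih hfac (by positivity) (by positivity)

theorem tendsto_coef_zero {μ : ℝ} (hμ : 0 ≤ μ) (hμ₁ : μ < 1) :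
    Filter.Tendsto (coef μ) Filter.atTop (nhds 0) := by
  refine squeeze_zero (coef_nonneg hμ) (coef_le_rpow hμ hμ₁.le) ?_
  exact (tendsto_rpow_neg_atTop (sub_pos.2 hμ₁)).comp
    (Filter.tendsto_atTop_add_const_right _ _ tendsto_natCast_atTop_atTop)

theorem coef_eq_Gamma_div {μ : ℝ} (hμ : 0 < μ) (m : ℕ) :
    coef μ m = Real.Gamma (m + μ) / (Real.Gamma μ * Real.Gamma (m + 1)) := by
  have hG := (Real.Gamma_pos_of_pos hμ).ne'
  induction m with
  | zero => simp [hG]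
  | succ m ih =>
    have h1 : Real.Gamma ((m + 1 : ℕ) + μ) = (m + μ) * Real.Gamma (m + μ) := by
      rw [← Real.Gamma_add_one (by positivity)]
      push_cast
      ring_nf
    have h2 : Real.Gamma ((m + 1 : ℕ) + 1) = (m + 1) * Real.Gamma (m + 1) := by
      rw [← Real.Gamma_add_one (by positivity)]
      push_cast
      ring_nf
    have h3 : Real.Gamma ((m : ℝ) + 1) ≠ 0 := (Real.Gamma_pos_of_pos (by positivity)).ne'
    rw [coef_succ, ih, h1, h2]
    field_simp

/-! ### Fractional operators as convolutions on the grid. -/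

/-- The discrete convolution `∑_{j ≤ k} coef μ (k - j) y_j`. -/
noncomputable def coefConv {E : Type*} [AddCommGroup E] [Module ℝ E] (μ : ℝ) (y : ℕ → E)
    (k : ℕ) : E :=
  ∑ j ∈ Finset.range (k + 1), coef μ (k - j) • y j

theorem coefConv_zero_left {E : Type*} [AddCommGroup E] [Module ℝ E] (y : ℕ → E) (k : ℕ) :
    coefConv 0 y k = y k := by
  rw [coefConv, Finset.sum_eq_single_of_mem k (by simp) fun j hj hne => ?_]
  · simp
  · have hm : 0 < k - j := by have := Finset.mem_range.1 hj; omega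
    rw [show coef 0 (k - j) = 0 from
      Finset.prod_eq_zero (Finset.mem_range.2 hm) (by simp), zero_smul]

theorem fracSum_grid {E : Type*} [AddCommGroup E] [Module ℝ E] {h μ : ℝ} (a : ℝ) (hh : 0 < h)
    (hμ : 0 ≤ μ) (y : ℝ → E) (k : ℕ) :
    fracSum h a μ y (a + μ * h + k * h) =
      h ^ μ • coefConv μ (fun j => y (a + j * h)) k := by
  rcases hμ.eq_or_lt with rfl | hμ
  · rw [coefConv_zero_left]
    simp [fracSum]
  · have hfl : (a + μ * h + k * h - a) / h - μ = k := by
      field_simp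
      ring
    rw [fracSum, coefConv, if_neg hμ.ne', hfl, Nat.floor_natCast, Finset.smul_sum, Finset.smul_sum]
    refine Finset.sum_congr rfl fun j hj => ?_
    have hjk : j ≤ k := by have := Finset.mem_range.1 hj; omega
    have e1 : (a + μ * h + k * h - (a + ((j : ℝ) + 1) * h)) / h + 1 = ((k - j : ℕ) : ℝ) + μ := by
      rw [Nat.cast_sub hjk]
      field_simp
      ring
    have e2 : ((k - j : ℕ) : ℝ) + μ - (μ - 1) = ((k - j : ℕ) : ℝ) + 1 := by ring
    rw [smul_smul, smul_smul, factorial, e1, e2, coef_eq_Gamma_div hμ, Real.rpow_sub_one hh.ne']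
    congr 1
    field_simp

/-- Separates the newest value, whose weight is `coef μ 0 = 1`, from the memory terms. -/
theorem coefConv_succ_sub {E : Type*} [AddCommGroup E] [Module ℝ E] (μ : ℝ) (y : ℕ → E) (k : ℕ) :
    coefConv μ y (k + 1) - coefConv μ y k =
      y (k + 1) -
        ∑ j ∈ Finset.range (k + 1), (coef μ (k - j) - coef μ (k - j + 1)) • y j := by
  rw [coefConv, Finset.sum_range_succ, coefConv]
  simp only [sub_smul, Finset.sum_sub_distrib, Nat.sub_self, coef_zero, one_smul]
  rw [Finset.sum_congr rfl fun j hj => by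
    rw [show k + 1 - j = k - j + 1 by have := Finset.mem_range.1 hj; omega]]
  abel

theorem rlDiff_grid {E : Type*} [AddCommGroup E] [Module ℝ E] {h ν : ℝ} (a : ℝ) (hh : 0 < h)
    (hν₀ : 0 < ν) (hν₁ : ν ≤ 1) (x : ℝ → E) (k : ℕ) :
    rlDiff h a ν x (a + (1 - ν) * h + k * h) =
      (h⁻¹ * h ^ (1 - ν)) • (coefConv (1 - ν) (fun j => x (a + j * h)) (k + 1) -
        coefConv (1 - ν) (fun j => x (a + j * h)) k) := by
  have hc : ⌈ν⌉₊ = 1 := (Nat.ceil_eq_iff one_ne_zero).2 ⟨by simpa using hν₀, by simpa using hν₁⟩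
  have hs : a + (1 - ν) * h + k * h + h = a + (1 - ν) * h + ((k + 1 : ℕ) : ℝ) * h := by
    push_cast
    ring
  rw [rlDiff, hc, Function.iterate_one, Nat.cast_one, forwardDiff, hs,
    fracSum_grid a hh (sub_nonneg.2 hν₁), fracSum_grid a hh (sub_nonneg.2 hν₁), ← smul_sub,
    smul_smul]

/-! ### Decay estimates in inner product spaces. -/

theorem norm_le_coef_mul {E : Type*} [NormedAddCommGroup E] [InnerProductSpace ℝ E] {ν : ℝ}
    (hν₀ : 0 ≤ ν) (hν₁ : ν ≤ 1) (y : ℕ → E)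
    (hy : ∀ k, inner ℝ (y (k + 1)) (coefConv (1 - ν) y (k + 1) - coefConv (1 - ν) y k) ≤ 0)
    (k : ℕ) : ‖y k‖ ≤ coef ν k * ‖y 0‖ := by
  induction k using Nat.strong_induction_on with
  | _ k ih =>
  cases k with
  | zero => simp
  | succ k =>
    set d : ℕ → ℝ := fun j => coef (1 - ν) (k - j) - coef (1 - ν) (k - j + 1)
    have hd : ∀ j, 0 ≤ d j := fun j =>
      sub_nonneg.2 (coef_succ_le (sub_nonneg.2 hν₁) (by linarith) _)
    -- The convolution of `coef (1 - ν)` with `coef ν` is constantly `1`, so its increment vanishes.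
    have hsum : ∑ j ∈ Finset.range (k + 1), d j * coef ν j = coef ν (k + 1) := by
      have hc := coefConv_succ_sub (1 - ν) (coef ν) k
      simp only [coefConv, smul_eq_mul] at hc
      rw [sum_range_coef_mul (by ring), sum_range_coef_mul (by ring)] at hc
      linarith
    have hin := hy k
    rw [coefConv_succ_sub, inner_sub_right, real_inner_self_eq_norm_sq, inner_sum] at hin
    have hle : ‖y (k + 1)‖ * ‖y (k + 1)‖ ≤ ‖y (k + 1)‖ * (coef ν (k + 1) * ‖y 0‖) := by
      calc ‖y (k + 1)‖ * ‖y (k + 1)‖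
          ≤ ∑ j ∈ Finset.range (k + 1), inner ℝ (y (k + 1)) (d j • y j) := by
            rw [← sq]
            exact sub_nonpos.1 hin
        _ ≤ ∑ j ∈ Finset.range (k + 1), ‖y (k + 1)‖ * (d j * coef ν j * ‖y 0‖) := by
            refine Finset.sum_le_sum fun j hj => ?_
            refine (real_inner_le_norm _ _).trans (mul_le_mul_of_nonneg_left ?_ (norm_nonneg _))
            rw [norm_smul, Real.norm_of_nonneg (hd j), mul_assoc]
            exact mul_le_mul_of_nonneg_left (ih j (Finset.mem_range.1 hj)) (hd j)
        _ = ‖y (k + 1)‖ * (coef ν (k + 1) * ‖y 0‖) := by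
            rw [← Finset.mul_sum, ← Finset.sum_mul, hsum]
    rcases (norm_nonneg (y (k + 1))).eq_or_lt with h0 | h0
    · rw [← h0]
      exact mul_nonneg (coef_nonneg hν₀ _) (norm_nonneg _)
    · exact le_of_mul_le_mul_left hle h0

/-- If the norms decreased to `r > 0`, Cauchy–Schwarz would bound the inner products below by a
sequence tending to `r * r - r * r = 0`, against the gap `η`. -/
theorem tendsto_norm_zero_of_inner_sub_le {E : Type*} [NormedAddCommGroup E]
    [InnerProductSpace ℝ E] (y : ℕ → E) (hanti : Antitone fun k => ‖y k‖)
    (hy : ∀ r > 0, (∀ k, r ≤ ‖y k‖) → ∃ η > 0, ∀ k, inner ℝ (y (k + 1)) (y (k + 1) - y k) ≤ -η) :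
    Filter.Tendsto (fun k => ‖y k‖) Filter.atTop (nhds 0) := by
  have hbdd : BddBelow (Set.range fun k => ‖y k‖) := ⟨0, by rintro _ ⟨k, rfl⟩; exact norm_nonneg _⟩
  have hlim := tendsto_atTop_ciInf hanti hbdd
  set r := ⨅ k, ‖y k‖
  have hr : 0 ≤ r := le_ciInf fun k => norm_nonneg _
  rcases hr.eq_or_lt with h0 | h0
  · rwa [← h0] at hlim
  · obtain ⟨η, hη, hk⟩ := hy r h0 fun k => ciInf_le hbdd k
    have hlim' := hlim.comp (Filter.tendsto_add_atTop_nat 1)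
    have hL : Filter.Tendsto (fun k => ‖y (k + 1)‖ * ‖y (k + 1)‖ - ‖y (k + 1)‖ * ‖y k‖)
        Filter.atTop (nhds (r * r - r * r)) := (hlim'.mul hlim').sub (hlim'.mul hlim)
    have : r * r - r * r ≤ -η := le_of_tendsto' hL fun k => by
      have h1 := hk k
      rw [inner_sub_right, real_inner_self_eq_norm_mul_norm] at h1
      linarith [real_inner_le_norm (y (k + 1)) (y k)]
    linarith

/-! ### Passage to the inner product defined by `P`. -/

-- Factor `P = Bᵀ B` and take `L = B`, which is injective because `P` is definite.
open scoped MatrixOrder in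
theorem exists_form_eq_inner {n : ℕ} {P : Matrix (Fin n) (Fin n) ℝ} (hP : P.PosDef) :
    ∃ L : EuclideanSpace ℝ (Fin n) ≃L[ℝ] EuclideanSpace ℝ (Fin n),
      ∀ u v, form P u v = inner ℝ (L u) (L v) := by
  obtain ⟨B, hB⟩ := CStarAlgebra.nonneg_iff_eq_star_mul_self.mp hP.posSemidef.nonneg
  have hform : ∀ u v, form P u v =
      inner ℝ (Matrix.toEuclideanLin B u) (Matrix.toEuclideanLin B v) := fun u v => by
    rw [form, hB, Matrix.star_eq_conjTranspose, ← Matrix.mulVec_mulVec, Matrix.dotProduct_mulVec,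
      EuclideanSpace.inner_eq_star_dotProduct, dotProduct_comm]
    simp [Matrix.vecMul_transpose, Matrix.conjTranspose_eq_transpose_of_trivial]
  have hinj : Function.Injective (Matrix.toEuclideanLin B) := by
    rw [← LinearMap.ker_eq_bot, LinearMap.ker_eq_bot']
    intro u hu
    by_contra hne
    have hpos := hP.dotProduct_mulVec_pos (x := u.ofLp) (by simpa using hne)
    have h0 := hform u u
    rw [hu, inner_zero_left] at h0
    exact hpos.ne' h0
  exact ⟨(LinearEquiv.ofInjectiveEndo _ hinj).toContinuousLinearEquiv, hform⟩

/-- The sequence `x(a), x(a + h), x(a + 2h), …` of grid values of `x`. -/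
def gridSeq {E : Type*} (h a : ℝ) (x : ℝ → E) (k : ℕ) : E := x (a + k * h)

theorem inner_coefConv_eq_form {n : ℕ} {h a ν : ℝ} (hh : 0 < h) (hν₀ : 0 < ν) (hν₁ : ν ≤ 1)
    {f : ℝ → EuclideanSpace ℝ (Fin n) → EuclideanSpace ℝ (Fin n)}
    {P : Matrix (Fin n) (Fin n) ℝ}
    {L : EuclideanSpace ℝ (Fin n) ≃L[ℝ] EuclideanSpace ℝ (Fin n)}
    (hL : ∀ u v, form P u v = inner ℝ (L u) (L v))
    {x₀ : EuclideanSpace ℝ (Fin n)} {x : ℝ → EuclideanSpace ℝ (Fin n)}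
    (hx : IsSolution h a ν f x₀ x) (k : ℕ) :
    inner ℝ (L (gridSeq h a x (k + 1)))
        (coefConv (1 - ν) (fun j => L (gridSeq h a x j)) (k + 1) -
          coefConv (1 - ν) (fun j => L (gridSeq h a x j)) k) =
      h ^ ν * form P (gridSeq h a x (k + 1))
        (f (a + (1 - ν) * h + k * h) (gridSeq h a x (k + 1))) := by
  have hmap : ∀ m, coefConv (1 - ν) (fun j => L (gridSeq h a x j)) m =
      L (coefConv (1 - ν) (gridSeq h a x) m) := fun m => by simp [coefConv, map_sum]
  have hs : a + (1 - ν) * h + k * h + ν * h = a + ((k + 1 : ℕ) : ℝ) * h := by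
    push_cast
    ring
  have heq := hx.1 (a + (1 - ν) * h + k * h) ⟨k, rfl⟩
  rw [rlDiff_grid a hh hν₀ hν₁, hs] at heq
  have hcoef : h ^ ν * (h⁻¹ * h ^ (1 - ν)) = 1 := by
    rw [mul_left_comm, ← Real.rpow_add hh, add_sub_cancel, Real.rpow_one, inv_mul_cancel₀ hh.ne']
  have heq' : coefConv (1 - ν) (gridSeq h a x) (k + 1) - coefConv (1 - ν) (gridSeq h a x) k =
      h ^ ν • f (a + (1 - ν) * h + k * h) (gridSeq h a x (k + 1)) := by
    rw [gridSeq, ← heq, smul_smul, hcoef, one_smul]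
    rfl
  rw [hmap, hmap, ← map_sub, heq', map_smul, inner_smul_right, hL]

/-- Every solution along which `xᵀ P f ≤ 0` decays, in the norm given by `P`, at least as fast as
`coef ν`. -/
theorem norm_gridSeq_le {n : ℕ} {h a ν : ℝ} (hh : 0 < h) (hν₀ : 0 < ν) (hν₁ : ν ≤ 1)
    {f : ℝ → EuclideanSpace ℝ (Fin n) → EuclideanSpace ℝ (Fin n)}
    {P : Matrix (Fin n) (Fin n) ℝ}
    {L : EuclideanSpace ℝ (Fin n) ≃L[ℝ] EuclideanSpace ℝ (Fin n)}
    (hL : ∀ u v, form P u v = inner ℝ (L u) (L v))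
    {x₀ : EuclideanSpace ℝ (Fin n)} {x : ℝ → EuclideanSpace ℝ (Fin n)}
    (hx : IsSolution h a ν f x₀ x)
    (hneg : ∀ t ∈ grid h (a + (1 - ν) * h), form P (x (t + ν * h)) (f t (x (t + ν * h))) ≤ 0)
    (k : ℕ) : ‖L (gridSeq h a x k)‖ ≤ coef ν k * ‖L (x a)‖ := by
  have h0 : gridSeq h a x 0 = x a := by simp [gridSeq]
  rw [← h0]
  refine norm_le_coef_mul hν₀.le hν₁ (fun j => L (gridSeq h a x j)) (fun k => ?_) k
  rw [inner_coefConv_eq_form hh hν₀ hν₁ hL hx]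
  refine mul_nonpos_of_nonneg_of_nonpos (by positivity) ?_
  have hs : a + (1 - ν) * h + k * h + ν * h = a + ((k + 1 : ℕ) : ℝ) * h := by
    push_cast
    ring
  simpa only [hs, gridSeq] using hneg _ ⟨k, rfl⟩

/-! ### Stability and attractivity. -/

theorem stable_of_form_nonpos {n : ℕ} {h a ν : ℝ} (hh : 0 < h) (hν₀ : 0 < ν) (hν₁ : ν ≤ 1)
    {f : ℝ → EuclideanSpace ℝ (Fin n) → EuclideanSpace ℝ (Fin n)}
    {P : Matrix (Fin n) (Fin n) ℝ} (hP : P.PosDef)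
    (hneg : ∀ x₀ x, IsSolution h a ν f x₀ x → ∀ t ∈ grid h (a + (1 - ν) * h),
      form P (x (t + ν * h)) (f t (x (t + ν * h))) ≤ 0) : Stable h a ν f := by
  obtain ⟨L, hL⟩ := exists_form_eq_inner hP
  intro ε hε
  obtain ⟨r, hr, hrε⟩ := Metric.continuousAt_iff.1 (L.symm.continuous.continuousAt (x := 0)) ε hε
  obtain ⟨δ, hδ, hδr⟩ := Metric.continuousAt_iff.1 (L.continuous.continuousAt (x := 0)) r hr
  simp only [map_zero, dist_zero_right] at hrε hδr
  refine ⟨δ, hδ, fun x₀ x hx hxa k => ?_⟩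
  have hk := (norm_gridSeq_le hh hν₀ hν₁ hL hx (hneg x₀ x hx) k).trans
    (mul_le_of_le_one_left (norm_nonneg _) (coef_le_one hν₀.le hν₁ k))
  simpa [gridSeq] using hrε (hk.trans_lt (hδr hxa))

theorem tendsto_gridSeq_zero_of_norm {n : ℕ} {h a : ℝ}
    (L : EuclideanSpace ℝ (Fin n) ≃L[ℝ] EuclideanSpace ℝ (Fin n))
    {x : ℝ → EuclideanSpace ℝ (Fin n)}
    (hx : Filter.Tendsto (fun k => ‖L (gridSeq h a x k)‖) Filter.atTop (nhds 0)) :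
    Filter.Tendsto (fun k : ℕ => x (a + (k : ℝ) * h)) Filter.atTop (nhds 0) := by
  simpa [Function.comp_def, gridSeq] using
    (L.symm.continuous.tendsto 0).comp (tendsto_zero_iff_norm_tendsto_zero.2 hx)

theorem attractive_of_form_nonpos {n : ℕ} {h a ν : ℝ} (hh : 0 < h) (hν₀ : 0 < ν) (hν₁ : ν < 1)
    {f : ℝ → EuclideanSpace ℝ (Fin n) → EuclideanSpace ℝ (Fin n)}
    {P : Matrix (Fin n) (Fin n) ℝ} (hP : P.PosDef)
    (hneg : ∀ x₀ x, IsSolution h a ν f x₀ x → ∀ t ∈ grid h (a + (1 - ν) * h),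
      form P (x (t + ν * h)) (f t (x (t + ν * h))) ≤ 0) : Attractive h a ν f := by
  obtain ⟨L, hL⟩ := exists_form_eq_inner hP
  refine ⟨1, one_pos, fun x₀ x hx _ => tendsto_gridSeq_zero_of_norm L ?_⟩
  refine squeeze_zero (fun _ => norm_nonneg _)
    (norm_gridSeq_le hh hν₀ hν₁.le hL hx (hneg x₀ x hx)) ?_
  simpa using (tendsto_coef_zero hν₀.le hν₁).mul_const ‖L (x a)‖

theorem attractive_one_of_form_le_neg {n : ℕ} {h a : ℝ} (hh : 0 < h)
    {f : ℝ → EuclideanSpace ℝ (Fin n) → EuclideanSpace ℝ (Fin n)}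
    {P : Matrix (Fin n) (Fin n) ℝ} (hP : P.PosDef)
    (hneg : ∀ x₀ x, IsSolution h a 1 f x₀ x → ∀ t ∈ grid h (a + (1 - 1) * h),
      form P (x (t + 1 * h)) (f t (x (t + 1 * h))) ≤ 0)
    {ρ : ℝ} (hρ : 0 < ρ) {φ : ℝ → ℝ} (hφ : ClassK ρ φ)
    (hle : ∀ x₀ x, IsSolution h a 1 f x₀ x → ∀ t ∈ grid h (a + (1 - 1) * h),
      ‖x (t + 1 * h)‖ < ρ →
        form P (x (t + 1 * h)) (f t (x (t + 1 * h))) ≤ -φ ‖x (t + 1 * h)‖) :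
    Attractive h a 1 f := by
  obtain ⟨L, hL⟩ := exists_form_eq_inner hP
  -- Stability with `ε = ρ` keeps the trajectory inside the domain of `φ`.
  obtain ⟨δ, hδ, hδρ⟩ := stable_of_form_nonpos hh one_pos le_rfl hP hneg ρ hρ
  refine ⟨δ, hδ, fun x₀ x hx hxa => tendsto_gridSeq_zero_of_norm L ?_⟩
  have hxρ : ∀ k, ‖gridSeq h a x k‖ < ρ := hδρ x₀ x hx hxa
  have hinner : ∀ k, inner ℝ (L (gridSeq h a x (k + 1)))
      (L (gridSeq h a x (k + 1)) - L (gridSeq h a x k)) =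
        h * form P (gridSeq h a x (k + 1))
          (f (a + (1 - 1) * h + k * h) (gridSeq h a x (k + 1))) := fun k => by
    have := inner_coefConv_eq_form hh one_pos le_rfl hL hx k
    -- `1 - 1` becomes `0` to collapse the convolution, then is restored in the time argument of
    -- `f`.
    rwa [sub_self, coefConv_zero_left, coefConv_zero_left, Real.rpow_one, ← sub_self (1 : ℝ)]
      at this
  have hs : ∀ k : ℕ, a + (1 - 1) * h + k * h + 1 * h = a + ((k + 1 : ℕ) : ℝ) * h := fun k => by
    push_cast
    ring
  refine tendsto_norm_zero_of_inner_sub_le _ (antitone_nat_of_succ_le fun k => ?_)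
    fun r hr hrk => ?_
  · have hk : form P (gridSeq h a x (k + 1))
        (f (a + (1 - 1) * h + k * h) (gridSeq h a x (k + 1))) ≤ 0 := by
      simpa only [hs, gridSeq] using hneg x₀ x hx _ ⟨k, rfl⟩
    have hk' := (hinner k).trans_le (mul_nonpos_of_nonneg_of_nonpos hh.le hk)
    rw [inner_sub_right, real_inner_self_eq_norm_mul_norm] at hk'
    by_contra! hlt
    have := real_inner_le_norm (L (gridSeq h a x (k + 1))) (L (gridSeq h a x k))
    nlinarith [norm_nonneg (L (gridSeq h a x k))]
  -- A lower bound `r` on `‖L y‖` forces a lower bound `s` on `‖y‖`, so monotonicity of `φ` gives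
  -- the gap `h * φ s`.
  · obtain ⟨s, hs₀, hsr⟩ := Metric.continuousAt_iff.1 (L.continuous.continuousAt (x := 0)) r hr
    simp only [map_zero, dist_zero_right] at hsr
    have hsk : ∀ k, s ≤ ‖gridSeq h a x k‖ := fun k => by
      by_contra! hlt
      exact (hrk k).not_gt (hsr hlt)
    have hsρ : s < ρ := (hsk 0).trans_lt (hxρ 0)
    have hφs : 0 < φ s := by
      have := hφ.2.2 ⟨le_rfl, hρ⟩ ⟨hs₀.le, hsρ⟩ hs₀
      rwa [hφ.2.1] at this
    refine ⟨h * φ s, by positivity, fun k => ?_⟩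
    rw [hinner k, ← mul_neg]
    refine mul_le_mul_of_nonneg_left ?_ hh.le
    have hk := hle x₀ x hx _ ⟨k, rfl⟩
    simp only [hs] at hk
    refine (hk (hxρ (k + 1))).trans (neg_le_neg ?_)
    exact hφ.2.2.monotoneOn ⟨hs₀.le, hsρ⟩ ⟨norm_nonneg _, hxρ (k + 1)⟩ (hsk (k + 1))

end HDiff

theorem mainTheorem2 (n : ℕ) (h a ν : ℝ) (hh : 0 < h) (hν₀ : 0 < ν) (hν₁ : ν ≤ 1)
    (f : ℝ → EuclideanSpace ℝ (Fin n) → EuclideanSpace ℝ (Fin n))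
    (hf : ∀ t ∈ HDiff.grid h (a + (1 - ν) * h), Continuous (f t))
    (hEq : HDiff.IsEquilibrium h a ν f 0)
    (P : Matrix (Fin n) (Fin n) ℝ) (hP : P.PosDef) :
    ((∀ x₀ x, HDiff.IsSolution h a ν f x₀ x → ∀ t ∈ HDiff.grid h (a + (1 - ν) * h),
        HDiff.form P (x (t + ν * h)) (f t (x (t + ν * h))) ≤ 0) →
      HDiff.Stable h a ν f) ∧
    ((∀ x₀ x, HDiff.IsSolution h a ν f x₀ x → ∀ t ∈ HDiff.grid h (a + (1 - ν) * h),
        x (t + ν * h) ≠ 0 → HDiff.form P (x (t + ν * h)) (f t (x (t + ν * h))) < 0) →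
      (ν = 1 → ∃ ρ > 0, ∃ φ, HDiff.ClassK ρ φ ∧
        ∀ x₀ x, HDiff.IsSolution h a ν f x₀ x → ∀ t ∈ HDiff.grid h (a + (1 - ν) * h),
          ‖x (t + ν * h)‖ < ρ →
            HDiff.form P (x (t + ν * h)) (f t (x (t + ν * h))) ≤ -φ ‖x (t + ν * h)‖) →
      HDiff.AsymptoticallyStable h a ν f) := by
  refine ⟨HDiff.stable_of_form_nonpos hh hν₀ hν₁ hP, fun hlt hunif => ?_⟩
  have hneg : ∀ x₀ x, HDiff.IsSolution h a ν f x₀ x → ∀ t ∈ HDiff.grid h (a + (1 - ν) * h),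
      HDiff.form P (x (t + ν * h)) (f t (x (t + ν * h))) ≤ 0 := fun x₀ x hx t ht => by
    by_cases h0 : x (t + ν * h) = 0
    · simp [HDiff.form, h0]
    · exact (hlt x₀ x hx t ht h0).le
  refine ⟨HDiff.stable_of_form_nonpos hh hν₀ hν₁ hP hneg, ?_⟩
  rcases hν₁.lt_or_eq with hν | rfl
  · exact HDiff.attractive_of_form_nonpos hh hν₀ hν hP hneg
  · obtain ⟨ρ, hρ, φ, hφ, hle⟩ := hunif rfl
    exact HDiff.attractive_one_of_form_le_neg hh hP hneg hρ hφ hle
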